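/- For an integer $q\ge 2$ let $\bar{\mathbf y}^q=\left(-\frac{q-1}{2},-\frac{q-3}{2},\dots,\frac{q-3}{2},\frac{q-1}{2}\right)\in\mathbb R^q$ be the vector obtained from $(1,2,\dots,q)$ by subtracting its mean $\frac{q+1}{2}$ from each coordinate, let $\Pi(\bar{\mathbf y}^q)$ be the set of the $q!$ vectors obtained from it by permuting coordinates, and let $\tilde{\mathcal M}^{q-1}=\{v\in\mathbb R^q : v_1+\dots+v_q=0\}$. Let the regular permutohedron $\tilde{\mathfrak R}^q$ be the convex hull of $\Pi(\bar{\mathbf y}^q)$, and let $\tilde{\mathfrak B}^q=\{v\in\tilde{\mathcal M}^{q-1} : \|v\|\le\|\bar{\mathbf y}^q\|\}$ be its circumscribed $(q-1)$-dimensional ball, where $\|\cdot\|$ is the Euclidean norm. Let $\mathrm{Vol}$ denote $(q-1)$-dimensional Euclidean volume. **Proposition 7.1.** As $q\to\infty$, $\mathrm{Vol}(\tilde{\mathfrak R}^q)/\mathrm{Vol}(\tilde{\mathfrak B}^q)\to 0$ at a geometric rate: there are constants $C>0$ and $0<r<1$ such that $$\frac{\mathrm{Vol}(\tilde{\mathfrak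 R}^q)}{\mathrm{Vol}(\tilde{\mathfrak B}^q)}\le C\,r^{q}\qquad\text{for all } q\ge 2 .$$ Moreover, $$\frac{\mathrm{Vol}(\tilde{\mathfrak R}^q)}{\mathrm{Vol}(\tilde{\mathfrak B}^q)}\sim\left(\frac{\pi}{e}\right)^{1/2}\left(\frac{6}{\pi e}\right)^{(q-1)/2}\qquad (q\to\infty),$$ where $a_q\sim b_q$ means $a_q/b_q\to1$. -/

import Mathlib

open MeasureTheory Filter Asymptotics

namespace Permutohedron

noncomputable section

/-- The arithmetic mean of the coordinates of a vector of `ℝ^q`. -/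
def mean {q : ℕ} (x : EuclideanSpace ℝ (Fin q)) : ℝ := (∑ i, x i) / (q : ℝ)

/-- The centering map `x ↦ x - (mean x) e`, where `e = (1, …, 1)`; for `q ≥ 1` it is the orthogonal
projection of `ℝ^q` onto the hyperplane of the vectors with coordinate sum zero. -/
def center {q : ℕ} (x : EuclideanSpace ℝ (Fin q)) : EuclideanSpace ℝ (Fin q) :=
  WithLp.toLp 2 fun i => x i - mean x

/-- The linear subspace of `ℝ^q` of the vectors with coordinate sum zero. -/
def sumZero (q : ℕ) : Submodule ℝ (EuclideanSpace ℝ (Fin q)) where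
  carrier := {v | ∑ i, v i = 0}
  add_mem' := by
    intro a b ha hb
    simp only [Set.mem_ofPred_eq, PiLp.add_apply, Finset.sum_add_distrib] at *
    rw [ha, hb, add_zero]
  zero_mem' := by simp
  smul_mem' := by
    intro c x hx
    simp only [Set.mem_ofPred_eq, PiLp.smul_apply, smul_eq_mul, ← Finset.mul_sum] at *
    rw [hx, mul_zero]

/-- The set `Π(x)` of all vectors obtained by permuting the coordinates of `x`. -/
def perms {q : ℕ} (x : EuclideanSpace ℝ (Fin q)) : Set (EuclideanSpace ℝ (Fin q)) :=
  Set.range fun σ : Equiv.Perm (Fin q) =>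
    (WithLp.toLp 2 fun i => x (σ i) : EuclideanSpace ℝ (Fin q))

/-- The regular configuration `(1, 2, …, q)`. -/
def regularX (q : ℕ) : EuclideanSpace ℝ (Fin q) :=
  WithLp.toLp 2 fun i => ((i : ℕ) : ℝ) + 1

/-- The centered regular configuration `(-(q-1)/2, -(q-3)/2, …, (q-1)/2)`. -/
def regularY (q : ℕ) : EuclideanSpace ℝ (Fin q) := center (regularX q)

/-- The (centered) regular permutohedron: the convex hull of all permutations of `regularY q`. -/
def regularPermutohedron (q : ℕ) : Set (EuclideanSpace ℝ (Fin q)) :=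
  convexHull ℝ (perms (regularY q))

/-- The circumscribed ball: the closed ball with centre `0` and radius `‖regularY q‖` in the
`(q-1)`-dimensional space `sumZero q`. -/
def circumscribedBall (q : ℕ) : Set (EuclideanSpace ℝ (Fin q)) :=
  Metric.closedBall 0 ‖regularY q‖ ∩ (sumZero q : Set (EuclideanSpace ℝ (Fin q)))

/-- The `(q-1)`-dimensional volume of a subset of `ℝ^q`: the Hausdorff measure of dimension `q-1`
normalized so that on a `(q-1)`-dimensional Euclidean subspace it is the Lebesgue measure. -/
def vol (q : ℕ) (S : Set (EuclideanSpace ℝ (Fin q))) : ℝ :=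
  (Measure.euclideanHausdorffMeasure (q - 1) S).toReal

/-- The volume of the regular permutohedron divided by that of its circumscribed ball. -/
def volumeRatio (q : ℕ) : ℝ :=
  vol q (regularPermutohedron q) / vol q (circumscribedBall q)

end

end Permutohedron

/-! Put n = q - 1. The permutohedron is exactly the Voronoi cell of 0 for the lattice in the
sum-zero hyperplane generated by the vectors (n+1)eᵢ - (1, …, 1). It therefore tiles the hyperplane,
and its volume is the covolume √(det Gram) = (n+1)^n / √(n+1).

Permutohedron ⊆ cell (`two_mul_sum_perm_le`): subtracting a lattice vector from a vertex shifts the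
entries, up to a common integer, by multiples of n+1. They stay distinct mod n+1, and the centred
residues minimise the norm. Cell ⊆ permutohedron (`mem_regularPermutohedron_of_voronoi`): lattice
vectors indexed by subsets give the subset-sum inequalities, and Hahn–Banach with Abel summation
concludes.

The ball has squared radius n(n+1)(n+2)/12, so the ratio is `closedForm n`. Stirling for n!, carried
to Γ(n/2+1) by the duplication formula and log-convexity, gives the asymptotics. Since 6/(πe) < 1,
the geometric bound and the limit 0 follow. -/

namespace Permutohedron

/-! ### Gamma at half-integers and asymptotics of the closed form. -/

open Real Topology

/-- Log-convexity of the Gamma function at a midpoint. -/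
lemma Gamma_add_half_sq_le {s : ℝ} (hs : 0 < s) :
    Gamma (s + 1 / 2) ^ 2 ≤ s * Gamma s ^ 2 := by
  have h := Gamma_mul_add_mul_le_rpow_Gamma_mul_rpow_Gamma hs (by positivity : 0 < s + 1)
    (by norm_num : (0 : ℝ) < 1 / 2) (by norm_num : (0 : ℝ) < 1 / 2) (by norm_num)
  rw [show 1 / 2 * s + 1 / 2 * (s + 1) = s + 1 / 2 by ring, ← sqrt_eq_rpow, ← sqrt_eq_rpow,
    Gamma_add_one hs.ne'] at h
  have hG := Gamma_pos_of_pos hs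
  have h2 := pow_le_pow_left₀ (Gamma_pos_of_pos (by positivity : 0 < s + 1 / 2)).le h 2
  rw [mul_pow, sq_sqrt hG.le, sq_sqrt (by positivity)] at h2
  nlinarith

/-- Legendre duplication at (n+1)/2. Log-convexity compares the two factors on the left, so each is
determined up to a factor tending to 1. -/
lemma Gamma_half_mul (n : ℕ) :
    Gamma (n / 2 + 1 / 2) * Gamma (n / 2 + 1) = n.factorial * √π / 2 ^ n := by
  have h := Gamma_mul_Gamma_add_half ((n : ℝ) / 2 + 1 / 2)
  rw [show (n : ℝ) / 2 + 1 / 2 + 1 / 2 = n / 2 + 1 by ring,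
    show 2 * ((n : ℝ) / 2 + 1 / 2) = n + 1 by ring, Gamma_nat_eq_factorial,
    show 1 - ((n : ℝ) + 1) = -n by ring, rpow_neg (by norm_num), rpow_natCast] at h
  rw [h]; field_simp

lemma Gamma_half_pow_four_le (n : ℕ) :
    Gamma (n / 2 + 1) ^ 4 ≤ (n.factorial * √π / 2 ^ n) ^ 2 * ((n + 1) / 2) := by
  have h := Gamma_add_half_sq_le (s := (n : ℝ) / 2 + 1 / 2) (by positivity)
  rw [show (n : ℝ) / 2 + 1 / 2 + 1 / 2 = n / 2 + 1 by ring] at h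
  rw [← Gamma_half_mul]
  nlinarith [sq_nonneg (Gamma ((n : ℝ) / 2 + 1)),
    mul_le_mul_of_nonneg_left h (sq_nonneg (Gamma ((n : ℝ) / 2 + 1)))]

/-- Log-convexity at n/2+1 bounds Γ(n/2+3/2) = ((n+1)/2) Γ(n/2+1/2), hence Γ(n/2+1/2), above by
Γ(n/2+1); the duplication product does the rest. -/
lemma le_Gamma_half_pow_four (n : ℕ) :
    (n.factorial * √π / 2 ^ n) ^ 2 * ((n + 1) ^ 2 / (2 * (n + 2))) ≤ Gamma (n / 2 + 1) ^ 4 := by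
  have h := Gamma_add_half_sq_le (s := (n : ℝ) / 2 + 1) (by positivity)
  have e := Gamma_add_one (s := (n : ℝ) / 2 + 1 / 2) (by positivity)
  rw [show (n : ℝ) / 2 + 1 / 2 + 1 = n / 2 + 1 + 1 / 2 by ring] at e
  rw [e] at h
  rw [← Gamma_half_mul, ← mul_div_assoc, div_le_iff₀ (by positivity)]
  nlinarith [mul_le_mul_of_nonneg_left h (sq_nonneg (Gamma ((n : ℝ) / 2 + 1)))]

lemma tendsto_Gamma_half_pow_four :
    Tendsto (fun n : ℕ => Gamma (n / 2 + 1) ^ 4 / (π * n * (n / (2 * exp 1)) ^ n) ^ 2)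
      atTop (𝓝 1) := by
  have hS : Tendsto (fun n : ℕ => ((n.factorial : ℝ) / (√(2 * n * π) * (n / exp 1) ^ n)) ^ 2)
      atTop (𝓝 1) := by
    have h := Stirling.factorial_isEquivalent_stirling
    rw [isEquivalent_iff_tendsto_one] at h
    · simpa using h.pow 2
    · filter_upwards [eventually_gt_atTop 0] with n hn
      positivity
  have hinv : Tendsto (fun n : ℕ => (1 : ℝ) / n) atTop (𝓝 0) := tendsto_one_div_atTop_nhds_zero_nat
  have hu : Tendsto (fun n : ℕ => ((n.factorial : ℝ) / (√(2 * n * π) * (n / exp 1) ^ n)) ^ 2 *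
      (1 + 1 / n)) atTop (𝓝 1) := by
    simpa using hS.mul (hinv.const_add 1)
  have hl : Tendsto (fun n : ℕ => ((n.factorial : ℝ) / (√(2 * n * π) * (n / exp 1) ^ n)) ^ 2 *
      ((1 + 1 / n) ^ 2 / (1 + 2 * (1 / n)))) atTop (𝓝 1) := by
    simpa using hS.mul (((hinv.const_add 1).pow 2).div ((hinv.const_mul 2).const_add 1) (by simp))
  -- The squared Stirling quotient is the common main term of both bounds; what remains are rational
  -- factors tending to 1.
  have key : ∀ n : ℕ, 0 < n → ((n.factorial : ℝ) / (√(2 * n * π) * (n / exp 1) ^ n)) ^ 2 =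
      (n.factorial * √π / 2 ^ n) ^ 2 * (n / 2) / (π * n * (n / (2 * exp 1)) ^ n) ^ 2 := by
    intro n hn
    have hn' : (0 : ℝ) < n := by exact_mod_cast hn
    rw [div_pow, mul_pow, sq_sqrt (by positivity), div_pow _ _ 2, mul_pow _ √π, sq_sqrt pi_nonneg,
      div_pow _ (exp 1), div_pow _ (2 * exp 1), mul_pow 2]
    field_simp
  refine tendsto_of_tendsto_of_tendsto_of_le_of_le' hl hu ?_ ?_
  · filter_upwards [eventually_gt_atTop 0] with n hn
    have hn' : (0 : ℝ) < n := by exact_mod_cast hn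
    rw [key n hn, div_mul_eq_mul_div]
    gcongr
    refine (le_of_eq ?_).trans (le_Gamma_half_pow_four n)
    rw [mul_assoc]
    congr 1
    field_simp
  · filter_upwards [eventually_gt_atTop 0] with n hn
    have hn' : (0 : ℝ) < n := by exact_mod_cast hn
    rw [key n hn, div_mul_eq_mul_div]
    gcongr
    refine (Gamma_half_pow_four_le n).trans (le_of_eq ?_)
    rw [mul_assoc]
    congr 1
    field_simp

/-- The source of the factor e^(-1/2) in the final constant: it comes from (n+1)^n against the n-th
power of the radius. -/
lemma tendsto_one_sub_inv_pow :
    Tendsto (fun n : ℕ => (((n : ℝ) + 1) / (n + 2)) ^ n) atTop (𝓝 (exp 1)⁻¹) := by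
  have h := tendsto_one_add_div_pow_exp (1 : ℝ)
  have h1 : Tendsto (fun n : ℕ => (1 + (1 : ℝ) / (n + 1 : ℕ)) ^ (n + 1)) atTop (𝓝 (exp 1)) :=
    h.comp (tendsto_add_atTop_nat 1)
  have hinv : Tendsto (fun n : ℕ => (1 : ℝ) / (n + 1 : ℕ)) atTop (𝓝 0) :=
    tendsto_one_div_atTop_nhds_zero_nat.comp (tendsto_add_atTop_nat 1)
  have h2 := (h1.div (hinv.const_add 1) (by simp)).inv₀ (by simp)
  simp only [add_zero, div_one] at h2
  refine h2.congr fun n => ?_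
  have : (1 : ℝ) + 1 / (n + 1 : ℕ) = (n + 2) / (n + 1) := by push_cast; field_simp; ring
  simp only [Pi.div_apply]
  rw [this, pow_succ, mul_div_assoc, div_self (by positivity), mul_one, ← inv_pow, inv_div]

/-- The closed form of the volume ratio in dimension `n = q - 1`. -/
noncomputable def closedForm (n : ℕ) : ℝ :=
  ((n + 1) ^ n / √(n + 1)) / (√(n * (n + 1) * (n + 2) / 12) ^ n * (√π ^ n / Gamma (n / 2 + 1)))

lemma tendsto_closedForm_div :
    Tendsto (fun n : ℕ => closedForm n /
      ((π / exp 1) ^ ((1 : ℝ) / 2) * (6 / (π * exp 1)) ^ ((n : ℝ) / 2))) atTop (𝓝 1) := by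
  have hinv : Tendsto (fun n : ℕ => (n : ℝ) / (n + 1)) atTop (𝓝 1) :=
    tendsto_natCast_div_add_atTop 1
  have h := (tendsto_Gamma_half_pow_four.mul (hinv.pow 2)).mul
    ((tendsto_one_sub_inv_pow.pow 2).const_mul (exp 1 ^ 2))
  -- The fourth power clears all square roots and half-integer exponents; nonnegativity allows two
  -- square roots to be taken at the end.
  have h4 : Tendsto (fun n : ℕ => (closedForm n /
      ((π / exp 1) ^ ((1 : ℝ) / 2) * (6 / (π * exp 1)) ^ ((n : ℝ) / 2))) ^ 4) atTop (𝓝 1) := by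
    have e1 : (1 : ℝ) * 1 ^ 2 * (exp 1 ^ 2 * (exp 1)⁻¹ ^ 2) = 1 := by
      have := exp_ne_zero 1
      field_simp
    rw [e1] at h
    refine h.congr' ?_
    filter_upwards [eventually_gt_atTop 0] with n hn
    have hn' : (0 : ℝ) < n := by exact_mod_cast hn
    have hr : ((6 / (π * exp 1)) ^ ((n : ℝ) / 2)) ^ 4 = ((6 / (π * exp 1)) ^ n) ^ 2 := by
      rw [← rpow_natCast, ← rpow_mul (by positivity),
        show (n : ℝ) / 2 * (4 : ℕ) = (n * 2 : ℕ) by push_cast; ring, rpow_natCast, pow_mul]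
    have hs : ∀ x : ℝ, 0 ≤ x → √x ^ 4 = x ^ 2 := fun x hx => by
      rw [show 4 = 2 * 2 from rfl, pow_mul, sq_sqrt hx]
    have hs' : ∀ x : ℝ, 0 ≤ x → (√x ^ n) ^ 4 = (x ^ n) ^ 2 := fun x hx => by
      rw [← pow_mul, mul_comm, pow_mul, hs x hx, ← pow_mul, ← pow_mul, mul_comm]
    have hG : 0 < Gamma ((n : ℝ) / 2 + 1) := Gamma_pos_of_pos (by positivity)
    have hT : ((π / exp 1) ^ ((1 : ℝ) / 2) * (6 / (π * exp 1)) ^ ((n : ℝ) / 2)) ^ 4 =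
        (π / exp 1) ^ 2 * ((6 / (π * exp 1)) ^ n) ^ 2 := by
      rw [mul_pow, hr, ← sqrt_eq_rpow, hs _ (by positivity)]
    have hC : closedForm n ^ 4 = (((n : ℝ) + 1) ^ n) ^ 4 / (n + 1) ^ 2 /
        (((n * (n + 1) * (n + 2) / 12 : ℝ) ^ n) ^ 2 *
          ((π ^ n) ^ 2 / Gamma ((n : ℝ) / 2 + 1) ^ 4)) := by
      unfold closedForm
      rw [div_pow, div_pow, mul_pow (√_ ^ n), div_pow (√π ^ n), hs _ (by positivity),
        hs' _ (by positivity), hs' _ (by positivity)]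
    rw [div_pow (closedForm n), hT, hC]
    simp only [div_pow, mul_pow]
    rw [show (12 : ℝ) = 6 * 2 by norm_num]
    simp only [mul_pow]
    field_simp
  have h0 : ∀ n : ℕ, 0 ≤ closedForm n /
      ((π / exp 1) ^ ((1 : ℝ) / 2) * (6 / (π * exp 1)) ^ ((n : ℝ) / 2)) := fun n => by
    have hG : 0 < Gamma ((n : ℝ) / 2 + 1) := Gamma_pos_of_pos (by positivity)
    unfold closedForm
    positivity
  have h5 := (h4.sqrt).sqrt
  simp only [sqrt_one] at h5
  refine h5.congr fun n => ?_
  have e : ∀ x : ℝ, x ^ 4 = (x ^ 2) ^ 2 := fun x => by ring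
  rw [e, sqrt_sq (sq_nonneg _), sqrt_sq (h0 n)]

end Permutohedron

namespace Permutohedron

open Finset

/-! ### Coordinates, norm and minimality of the centred residues. -/

section Combinatorics

lemma regularY_apply (n : ℕ) (i : Fin (n + 1)) : regularY (n + 1) i = (i : ℕ) - (n : ℝ) / 2 := by
  have h : ∑ j : Fin (n + 1), (((j : ℕ) : ℝ) + 1) = (n + 1) * (n + 2) / 2 := by
    rw [Fin.sum_univ_eq_sum_range (fun k => (k : ℝ) + 1)]
    induction n with
    | zero => simp
    | succ n ih => rw [sum_range_succ, ih 0]; push_cast; ring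
  simp only [regularY, center, mean, regularX]
  rw [h]
  push_cast
  field_simp
  ring

lemma sum_sq_sub_half (n : ℕ) :
    ∑ i : Fin (n + 1), (((i : ℕ) : ℝ) - n / 2) ^ 2 = (n : ℝ) * (n + 1) * (n + 2) / 12 := by
  have h : ∀ (c : ℝ) (m : ℕ), ∑ k ∈ range (m + 1), ((k : ℝ) - c) ^ 2 =
      ((m : ℝ) + 1) * (m * (2 * m + 1) / 6 - c * m + c ^ 2) := fun c m => by
    induction m with
    | zero => simp
    | succ m ih => rw [sum_range_succ, ih]; push_cast; ring
  rw [Fin.sum_univ_eq_sum_range (fun k => ((k : ℝ) - n / 2) ^ 2), h]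
  ring

lemma norm_regularY (n : ℕ) :
    ‖regularY (n + 1)‖ = √(n * (n + 1) * (n + 2) / 12) := by
  rw [EuclideanSpace.norm_eq, ← sum_sq_sub_half]
  simp only [regularY_apply, Real.norm_eq_abs, sq_abs]

/-- With z = r + (n+1)k, the squares differ by (n+1)·k·(2r + (n+1)k - n), and the last factor has
the sign of k when k ≠ 0, because 0 ≤ r ≤ n. -/
lemma sq_sub_half_emod_le (n : ℕ) (z : ℤ) :
    (((z % (n + 1 : ℤ) : ℤ) : ℝ) - n / 2) ^ 2 ≤ ((z : ℝ) - n / 2) ^ 2 := by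
  obtain ⟨r, k, hr⟩ : ∃ r k : ℤ, r = z % (n + 1 : ℤ) ∧ k = z / (n + 1 : ℤ) := ⟨_, _, rfl, rfl⟩
  obtain ⟨hr, hk⟩ := hr
  have h0 : 0 ≤ r := hr ▸ Int.emod_nonneg z (by omega)
  have h1 : r < n + 1 := hr ▸ Int.emod_lt_of_pos z (by omega)
  have hz : z = r + (n + 1) * k := by rw [hr, hk, Int.emod_add_mul_ediv]
  have hp : 0 ≤ k * (2 * r + (n + 1) * k - n) := by
    rcases lt_trichotomy k 0 with h | h | h
    · exact mul_nonneg_of_nonpos_of_nonpos h.le (by nlinarith)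
    · simp [h]
    · exact mul_nonneg h.le (by nlinarith)
  have hp' : (0 : ℝ) ≤ (n + 1) * (k * (2 * r + (n + 1) * k - n)) :=
    mul_nonneg (by positivity) (by exact_mod_cast hp)
  rw [← hr, hz]
  push_cast
  nlinarith

/-- Among the families representing every residue class modulo `n + 1`, the sum of the squared
distances to `n / 2` is minimal for `0, …, n`. -/
lemma sum_sq_sub_half_le (n : ℕ) (z : Fin (n + 1) → ℤ)
    (hz : Function.Injective fun i => z i % (n + 1 : ℤ)) :
    ∑ i : Fin (n + 1), (((i : ℕ) : ℝ) - n / 2) ^ 2 ≤ ∑ i, ((z i : ℝ) - n / 2) ^ 2 := by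
  have hlt : ∀ i, (z i % (n + 1 : ℤ)).toNat < n + 1 := fun i => by
    have h1 := Int.emod_lt_of_pos (z i) (by omega : (0 : ℤ) < n + 1)
    have h0 := Int.emod_nonneg (z i) (by omega : (n + 1 : ℤ) ≠ 0)
    omega
  have hcast : ∀ i, (((z i % (n + 1 : ℤ)).toNat : ℕ) : ℤ) = z i % (n + 1 : ℤ) := fun i =>
    Int.toNat_of_nonneg (Int.emod_nonneg (z i) (by omega))
  let ρ : Fin (n + 1) → Fin (n + 1) := fun i => ⟨_, hlt i⟩
  have hρ : Function.Bijective ρ := Finite.injective_iff_bijective.mp fun i j hij => hz (by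
    have := congrArg (fun k : Fin (n + 1) => ((k : ℕ) : ℤ)) hij
    simpa only [ρ, hcast] using this)
  rw [← hρ.sum_comp fun i : Fin (n + 1) => (((i : ℕ) : ℝ) - n / 2) ^ 2]
  refine sum_le_sum fun i _ => ?_
  have h := sq_sub_half_emod_le n (z i)
  rw [← hcast] at h
  exact_mod_cast h

/-- Abel summation: a monotone weight against a sequence with nonnegative partial sums. -/
lemma sum_mul_le_of_monotone {a d : ℕ → ℝ} (n : ℕ) (ha : ∀ k < n, a k ≤ a (k + 1))
    (hd : ∀ k ≤ n, 0 ≤ ∑ j ∈ range k, d j) :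
    ∑ j ∈ range (n + 1), a j * d j ≤ a n * ∑ j ∈ range (n + 1), d j := by
  induction n with
  | zero => simp
  | succ n ih =>
    rw [sum_range_succ, sum_range_succ _ (n + 1), mul_add]
    have h1 := ih (fun k hk => ha k (hk.trans (Nat.lt_succ_self n)))
      fun k hk => hd k (hk.trans (Nat.le_succ n))
    have h2 := mul_le_mul_of_nonneg_right (ha n (Nat.lt_succ_self n)) (hd (n + 1) le_rfl)
    linarith

end Combinatorics

/-! ### The lattice in the sum-zero hyperplane. -/

section Lattice

/-- The vector `(n + 1) eᵢ - (1, …, 1)`. -/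
noncomputable def facetVector (n : ℕ) (i : Fin (n + 1)) : sumZero (n + 1) :=
  ⟨WithLp.toLp 2 fun j => (if j = i then (n + 1 : ℝ) else 0) - 1, by
    change ∑ j : Fin (n + 1), ((if j = i then (n + 1 : ℝ) else 0) - 1) = 0
    simp⟩

lemma facetVector_apply (n : ℕ) (i j : Fin (n + 1)) :
    (facetVector n i : EuclideanSpace ℝ (Fin (n + 1))) j =
      (if j = i then (n + 1 : ℝ) else 0) - 1 := rfl

lemma sum_coe_eq_zero {q : ℕ} (x : sumZero q) : ∑ i, (x : EuclideanSpace ℝ (Fin q)) i = 0 := x.2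

lemma inner_sumZero {q : ℕ} (x y : sumZero q) :
    inner ℝ x y = ∑ i, (x : EuclideanSpace ℝ (Fin q)) i * (y : EuclideanSpace ℝ (Fin q)) i := by
  rw [Submodule.coe_inner, PiLp.inner_apply]
  exact sum_congr rfl fun i _ => by simp [mul_comm]

lemma inner_facetVector (n : ℕ) (x : sumZero (n + 1)) (i : Fin (n + 1)) :
    inner ℝ x (facetVector n i) = (n + 1) * (x : EuclideanSpace ℝ (Fin (n + 1))) i := by
  rw [inner_sumZero]
  simp only [facetVector_apply, mul_sub, sum_sub_distrib, mul_one, sum_coe_eq_zero]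
  simp [mul_comm]

lemma linearIndependent_facetVector (n : ℕ) :
    LinearIndependent ℝ fun i : Fin n => facetVector n i.castSucc := by
  rw [Fintype.linearIndependent_iff]
  intro g hg i
  have h : ∀ j, ∑ k : Fin n, g k * ((if j = k.castSucc then (n + 1 : ℝ) else 0) - 1) = 0 :=
    fun j => by
      have := congrArg (fun x : sumZero (n + 1) => (x : EuclideanSpace ℝ (Fin (n + 1))) j) hg
      simpa [facetVector_apply] using this
  -- The last coordinate gives ∑ g = 0; coordinate i then isolates g i.
  have hl := h (Fin.last n)
  have hi := h i.castSucc
  simp only [mul_sub, mul_one, sum_sub_distrib] at hl hi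
  have e1 : ∀ k : Fin n, (if Fin.last n = k.castSucc then (n + 1 : ℝ) else 0) = 0 := fun k =>
    if_neg (Fin.castSucc_lt_last k).ne'
  simp only [e1, mul_zero, sum_const_zero, zero_sub, neg_eq_zero] at hl
  rw [hl] at hi
  simp [Fin.castSucc_inj] at hi
  exact hi.resolve_right (by positivity)

lemma span_facetVector (n : ℕ) :
    ⊤ ≤ Submodule.span ℝ (Set.range fun i : Fin n => facetVector n i.castSucc) := by
  intro x _
  set y := (x : EuclideanSpace ℝ (Fin (n + 1))) with hy
  -- The coefficients sum to minus the last coordinate of x, which is what the -1 entries must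
  -- contribute.
  have hx : x = ∑ i : Fin n, ((y i.castSucc - y (Fin.last n)) / (n + 1)) •
      facetVector n i.castSucc := by
    have hs : ∑ i : Fin n, y i.castSucc = - y (Fin.last n) := by
      have := sum_coe_eq_zero x
      rw [Fin.sum_univ_castSucc] at this
      linarith
    have hn : (n : ℝ) + 1 ≠ 0 := by positivity
    have hs' : ∑ i : Fin n, (y i.castSucc - y (Fin.last n)) / (n + 1) = - y (Fin.last n) := by
      rw [← sum_div, sum_sub_distrib, hs]
      simp
      field_simp
      ring
    ext j
    simp only [Submodule.coe_sum, Submodule.coe_smul, WithLp.ofLp_sum, WithLp.ofLp_smul,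
      Finset.sum_apply, Pi.smul_apply, smul_eq_mul, facetVector_apply, mul_sub, mul_one,
      sum_sub_distrib, hs', ← hy]
    refine Fin.lastCases ?_ (fun j => ?_) j
    · have e1 : ∀ k : Fin n, (if Fin.last n = k.castSucc then (n + 1 : ℝ) else 0) = 0 := fun k =>
        if_neg (Fin.castSucc_lt_last k).ne'
      simp [e1]
    · simp [Fin.castSucc_inj]
      field_simp
      ring
  rw [hx]
  exact Submodule.sum_mem _ fun i _ => Submodule.smul_mem _ _ (Submodule.subset_span ⟨i, rfl⟩)

/-- The vectors `(n + 1) eᵢ - (1, …, 1)`, `i < n`, as a basis of the hyperplane. -/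
noncomputable def facetBasis (n : ℕ) : Module.Basis (Fin n) ℝ (sumZero (n + 1)) :=
  Module.Basis.mk (linearIndependent_facetVector n) (span_facetVector n)

lemma facetBasis_apply (n : ℕ) (i : Fin n) : facetBasis n i = facetVector n i.castSucc := by
  simp [facetBasis]

lemma finrank_sumZero (n : ℕ) : Module.finrank ℝ (sumZero (n + 1)) = n := by
  rw [Module.finrank_eq_card_basis (facetBasis n), Fintype.card_fin]

/-- The lattice generated by the vectors `(n + 1) eᵢ - (1, …, 1)`. -/
noncomputable def facetLattice (n : ℕ) : AddSubgroup (sumZero (n + 1)) :=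
  (Submodule.span ℤ (Set.range (facetBasis n))).toAddSubgroup

lemma facetVector_mem (n : ℕ) (i : Fin (n + 1)) : facetVector n i ∈ facetLattice n := by
  have h : ∀ i : Fin n, facetVector n i.castSucc ∈ facetLattice n := fun i =>
    Submodule.subset_span ⟨i, facetBasis_apply n i⟩
  refine Fin.lastCases ?_ h i
  have : facetVector n (Fin.last n) = - ∑ i : Fin n, facetVector n i.castSucc := by
    have h := Fin.sum_univ_castSucc (facetVector n)
    rw [eq_neg_iff_add_eq_zero, add_comm (facetVector n (Fin.last n)), ← h]
    ext j
    simp [facetVector_apply]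
  rw [this]
  exact neg_mem (sum_mem fun i _ => h i)

/-- All coordinates share one residue -c mod n+1, so subtracting a lattice vector preserves
distinctness of residues. -/
lemma exists_coord_of_mem {n : ℕ} {v : sumZero (n + 1)} (hv : v ∈ facetLattice n) :
    ∃ (m : Fin (n + 1) → ℤ) (c : ℤ),
      ∀ j, (v : EuclideanSpace ℝ (Fin (n + 1))) j = (n + 1) * m j - c := by
  change v ∈ Submodule.span ℤ (Set.range (facetBasis n)) at hv
  induction hv using Submodule.span_induction with
  | mem x hx =>
    obtain ⟨i, rfl⟩ := hx
    refine ⟨fun j => if j = i.castSucc then 1 else 0, 1, fun j => ?_⟩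
    rw [facetBasis_apply, facetVector_apply]
    by_cases h : j = i.castSucc <;> simp [h]
  | zero => exact ⟨0, 0, fun j => by simp⟩
  | add x y _ _ hx hy =>
    obtain ⟨m, c, h⟩ := hx
    obtain ⟨m', c', h'⟩ := hy
    refine ⟨m + m', c + c', fun j => ?_⟩
    simp only [Submodule.coe_add, PiLp.add_apply, h, h', Pi.add_apply]
    push_cast
    ring
  | smul a x _ hx =>
    obtain ⟨m, c, h⟩ := hx
    refine ⟨a • m, a * c, fun j => ?_⟩
    rw [← Int.cast_smul_eq_zsmul ℝ a x]
    simp only [Submodule.coe_smul, PiLp.smul_apply, h, Pi.smul_apply, smul_eq_mul]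
    push_cast
    ring

end Lattice

end Permutohedron

namespace Permutohedron

open Finset

/-! ### The permutohedron is the Voronoi cell. -/

section VoronoiCell

lemma mem_regularPermutohedron_of_perm (n : ℕ) (σ : Equiv.Perm (Fin (n + 1))) :
    (WithLp.toLp 2 fun i => regularY (n + 1) (σ i) : EuclideanSpace ℝ (Fin (n + 1))) ∈
      regularPermutohedron (n + 1) :=
  subset_convexHull _ _ ⟨σ, rfl⟩

lemma regularPermutohedron_subset_sumZero (n : ℕ) :
    regularPermutohedron (n + 1) ⊆ sumZero (n + 1) := by
  refine convexHull_min ?_ (sumZero (n + 1)).convex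
  rintro _ ⟨σ, rfl⟩
  change ∑ i, regularY (n + 1) (σ i) = 0
  rw [Equiv.sum_comp σ fun i => regularY (n + 1) i]
  simp only [regularY, center, mean, sum_sub_distrib, sum_const, card_univ, Fintype.card_fin,
    nsmul_eq_mul]
  rw [mul_div_cancel₀ _ (by positivity), sub_self]

lemma isClosed_regularPermutohedron (q : ℕ) : IsClosed (regularPermutohedron q) :=
  (Set.finite_range _).isClosed_convexHull ℝ

/-- For the vertex y given by σ, the entries of y - v + n/2 are integers with distinct residues mod
n+1. Hence ‖y‖² ≤ ‖y - v‖², and expanding gives the claim. -/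
lemma two_mul_sum_perm_le {n : ℕ} (σ : Equiv.Perm (Fin (n + 1))) {v : sumZero (n + 1)}
    (hv : v ∈ facetLattice n) :
    2 * ∑ i, regularY (n + 1) (σ i) * (v : EuclideanSpace ℝ (Fin (n + 1))) i ≤ ‖v‖ ^ 2 := by
  obtain ⟨m, c, h⟩ := exists_coord_of_mem hv
  have hle := sum_sq_sub_half_le n (fun i => ((σ i : ℕ) : ℤ) + c - (n + 1) * m i) (by
    intro i j hij
    have h1 : ((n + 1 : ℕ) : ℤ) ∣ ((σ j : ℕ) : ℤ) - ((σ i : ℕ) : ℤ) := by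
      have h2 := Int.ModEq.dvd (show _ ≡ _ [ZMOD (n + 1 : ℤ)] from hij)
      have h3 := dvd_add h2 (dvd_mul_right (n + 1 : ℤ) (m j - m i))
      push_cast
      rwa [show ∀ a b c p q : ℤ, a + c - (n + 1) * p - (b + c - (n + 1) * q) +
        (n + 1) * (p - q) = a - b from fun _ _ _ _ _ => by ring] at h3
    have h4 := Int.modEq_iff_dvd.mpr h1
    have h5 := Nat.ModEq.eq_of_lt_of_lt (Int.natCast_modEq_iff.mp h4) (σ i).2 (σ j).2
    exact σ.injective (Fin.ext h5))
  rw [← Equiv.sum_comp σ] at hle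
  have hR : ∀ i, ((((σ i : ℕ) : ℤ) + c - (n + 1) * m i : ℤ) : ℝ) - (n : ℝ) / 2 =
      regularY (n + 1) (σ i) - (v : EuclideanSpace ℝ (Fin (n + 1))) i := fun i => by
    rw [regularY_apply, h]
    push_cast
    ring
  simp only [hR] at hle
  simp only [← regularY_apply] at hle
  rw [← real_inner_self_eq_norm_sq, inner_sumZero, mul_sum, ← sub_nonneg, ← sum_sub_distrib]
  rw [← sub_nonneg, ← sum_sub_distrib] at hle
  refine hle.trans_eq (sum_congr rfl fun i _ => ?_)
  ring

/-- The permutohedron is contained in the Voronoi cell of `facetLattice n`. -/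
lemma two_mul_inner_le {n : ℕ} {x v : sumZero (n + 1)}
    (hx : (x : EuclideanSpace ℝ (Fin (n + 1))) ∈ regularPermutohedron (n + 1))
    (hv : v ∈ facetLattice n) : 2 * inner ℝ v x ≤ ‖v‖ ^ 2 := by
  have hsub : regularPermutohedron (n + 1) ⊆
      {y | inner ℝ (v : EuclideanSpace ℝ (Fin (n + 1))) y ≤ ‖v‖ ^ 2 / 2} := by
    refine convexHull_min ?_ (convex_halfSpace_le (innerₗ _ _).isLinear _)
    rintro _ ⟨σ, rfl⟩
    have h := two_mul_sum_perm_le σ hv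
    rw [Set.mem_ofPred_eq, PiLp.inner_apply]
    simp only [RCLike.inner_apply, conj_trivial]
    linarith
  have h : inner ℝ v x ≤ ‖v‖ ^ 2 / 2 := hsub hx
  linarith

/-- Points of the Voronoi cell satisfy the subset-sum inequalities of the permutohedron. -/
lemma le_sum_of_voronoi {n : ℕ} {x : sumZero (n + 1)}
    (hx : ∀ v ∈ facetLattice n, 2 * inner ℝ v x ≤ ‖v‖ ^ 2) (s : Finset (Fin (n + 1))) :
    -((#s : ℝ) * (n + 1 - #s) / 2) ≤ ∑ i ∈ s, (x : EuclideanSpace ℝ (Fin (n + 1))) i := by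
  have hin : ∀ y : sumZero (n + 1), inner ℝ y (∑ i ∈ s, facetVector n i) =
      (n + 1) * ∑ i ∈ s, (y : EuclideanSpace ℝ (Fin (n + 1))) i := fun y => by
    rw [inner_sum, mul_sum]
    exact sum_congr rfl fun i _ => inner_facetVector n y i
  have hco : ∀ j, ((∑ i ∈ s, facetVector n i : sumZero (n + 1)) :
      EuclideanSpace ℝ (Fin (n + 1))) j = (if j ∈ s then (n + 1 : ℝ) else 0) - #s := fun j => by
    simp [facetVector_apply]
  -- The test vector has squared norm (n+1)·#s·(n+1-#s); the sign turns the Voronoi inequality into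
  -- a lower bound.
  have h := hx (-∑ i ∈ s, facetVector n i) (neg_mem (sum_mem fun i _ => facetVector_mem n i))
  rw [norm_neg, inner_neg_left, real_inner_comm, hin, ← real_inner_self_eq_norm_sq, hin] at h
  have hs : ∑ j ∈ s, ((∑ i ∈ s, facetVector n i : sumZero (n + 1)) :
      EuclideanSpace ℝ (Fin (n + 1))) j = #s * (n + 1 - #s) := by
    rw [sum_congr rfl fun j hj => by rw [hco, if_pos hj], sum_const, nsmul_eq_mul]
  rw [hs] at h
  have hn : (0 : ℝ) < n + 1 := by positivity
  have h' : 0 ≤ (n + 1 : ℝ) * (#s * (n + 1 - #s) +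
      2 * ∑ i ∈ s, (x : EuclideanSpace ℝ (Fin (n + 1))) i) := by linarith
  have := nonneg_of_mul_nonneg_right h' hn
  linarith

/-- The Voronoi cell of `facetLattice n` is contained in the permutohedron. -/
lemma mem_regularPermutohedron_of_voronoi {n : ℕ} {x : sumZero (n + 1)}
    (hx : ∀ v ∈ facetLattice n, 2 * inner ℝ v x ≤ ‖v‖ ^ 2) :
    (x : EuclideanSpace ℝ (Fin (n + 1))) ∈ regularPermutohedron (n + 1) := by
  by_contra hnot
  obtain ⟨f, u, hfu, hux⟩ := geometric_hahn_banach_closed_point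
    (convex_convexHull ℝ _) (isClosed_regularPermutohedron (n + 1)) hnot
  obtain ⟨w, hw⟩ := (InnerProductSpace.toDual ℝ (EuclideanSpace ℝ (Fin (n + 1)))).surjective f
  have hf : ∀ y, f y = ∑ i, w i * y i := fun y => by
    rw [← hw, InnerProductSpace.toDual_apply_apply, PiLp.inner_apply]
    exact sum_congr rfl fun i _ => by simp [mul_comm]
  -- The vertex ordered like w should maximise the separating functional; Abel summation will show
  -- that its value is at least that at x.
  set σ : Equiv.Perm (Fin (n + 1)) := Tuple.sort w with hσ
  have hmono : Monotone (w ∘ σ) := Tuple.monotone_sort w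
  have hlt := (hfu _ (mem_regularPermutohedron_of_perm n σ.symm)).trans hux
  rw [hf, hf, ← Equiv.sum_comp σ, ← Equiv.sum_comp σ (fun i => w i * _)] at hlt
  simp only [Equiv.symm_apply_apply] at hlt
  let a : ℕ → ℝ := fun k => w (σ (Fin.ofNat (n + 1) k))
  let b : ℕ → ℝ := fun k => (x : EuclideanSpace ℝ (Fin (n + 1))) (σ (Fin.ofNat (n + 1) k))
  -- The difference of x and that vertex, in sorted order. Its partial sums are nonnegative by the
  -- subset-sum inequalities, and its total is 0.
  let d : ℕ → ℝ := fun k => b k - ((k : ℝ) - n / 2)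
  have hof : ∀ i : Fin (n + 1), Fin.ofNat (n + 1) (i : ℕ) = i := fun i => by simp
  have hsumid : ∀ k : ℕ, ∑ j ∈ range k, ((j : ℝ) - n / 2) = -((k : ℝ) * (n + 1 - k) / 2) :=
    fun k => by
      induction k with
      | zero => simp
      | succ k ih => rw [sum_range_succ, ih]; push_cast; ring
  have hd : ∀ k ≤ n + 1, 0 ≤ ∑ j ∈ range k, d j := fun k hk => by
    have hinj : Set.InjOn (fun j => σ (Fin.ofNat (n + 1) j)) (range k : Set ℕ) := by
      intro i hi j hj hij
      have h1 := σ.injective hij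
      have hi' : i < n + 1 := (mem_range.mp hi).trans_le hk
      have hj' : j < n + 1 := (mem_range.mp hj).trans_le hk
      simpa [Fin.ext_iff, Nat.mod_eq_of_lt hi', Nat.mod_eq_of_lt hj'] using h1
    have h := le_sum_of_voronoi hx ((range k).image fun j => σ (Fin.ofNat (n + 1) j))
    rw [sum_image hinj, card_image_of_injOn hinj, card_range] at h
    simp only [d, sum_sub_distrib _ (fun j : ℕ => (j : ℝ) - n / 2), hsumid]
    linarith
  have hd0 : ∑ j ∈ range (n + 1), d j = 0 := by
    simp only [d, sum_sub_distrib _ (fun j : ℕ => (j : ℝ) - n / 2), hsumid]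
    rw [← Fin.sum_univ_eq_sum_range b (n + 1)]
    simp only [b, hof]
    rw [Equiv.sum_comp σ fun i => (x : EuclideanSpace ℝ (Fin (n + 1))) i, sum_coe_eq_zero]
    push_cast
    ring
  have habel := sum_mul_le_of_monotone (a := a) n (fun k hk => hmono (by
    rw [Fin.le_def]
    simp [Nat.mod_eq_of_lt (show k < n + 1 by omega),
      Nat.mod_eq_of_lt (show k + 1 < n + 1 by omega)])) fun k hk => hd k (by omega)
  rw [hd0, mul_zero, ← Fin.sum_univ_eq_sum_range (fun j => a j * d j)] at habel
  simp only [a, b, d, hof, mul_sub, sum_sub_distrib] at habel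
  simp only [regularY_apply, mul_sub, sum_sub_distrib] at hlt
  linarith

/-- Every point has a nearest point of the lattice. -/
lemma exists_nearest (n : ℕ) (x : sumZero (n + 1)) :
    ∃ v ∈ facetLattice n, ∀ u ∈ facetLattice n, ‖x - v‖ ≤ ‖x - u‖ := by
  -- The ball about x of radius ‖x‖ contains 0 and only finitely many lattice points, and points
  -- outside it are farther from x than 0 is.
  have hfin := ZSpan.setFinite_inter (facetBasis n)
    (Metric.isBounded_closedBall (x := x) (r := ‖x‖))
  obtain ⟨v, hv, hmin⟩ := Set.exists_min_image _ (fun v => ‖x - v‖) hfin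
    ⟨0, by simp, zero_mem (facetLattice n)⟩
  refine ⟨v, hv.2, fun u hu => ?_⟩
  by_cases hux : u ∈ Metric.closedBall x ‖x‖
  · exact hmin u ⟨hux, hu⟩
  · rw [Metric.mem_closedBall, not_le, dist_comm, dist_eq_norm] at hux
    have h1 := hmin 0 ⟨by simp, zero_mem (facetLattice n)⟩
    simp only [sub_zero] at h1
    exact h1.trans hux.le

/-- Translates of the cell cover: for v nearest to x, expanding ‖x - v‖² ≤ ‖x - v - u‖² gives the
Voronoi inequality for each u. -/
lemma exists_sub_mem_regularPermutohedron (n : ℕ) (x : sumZero (n + 1)) :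
    ∃ v ∈ facetLattice n, ((x - v : sumZero (n + 1)) : EuclideanSpace ℝ (Fin (n + 1))) ∈
      regularPermutohedron (n + 1) := by
  obtain ⟨v, hv, hmin⟩ := exists_nearest n x
  refine ⟨v, hv, mem_regularPermutohedron_of_voronoi fun u hu => ?_⟩
  have h := hmin (v + u) (add_mem hv hu)
  rw [← sub_sub] at h
  have h2 := pow_le_pow_left₀ (norm_nonneg _) h 2
  rw [norm_sub_sq_real (x - v) u, real_inner_comm] at h2
  linarith

end VoronoiCell

/-! ### Volumes of the permutohedron and of the ball. -/

section Volume

/-- The permutohedron as a subset of the hyperplane. -/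
def permutohedronCell (n : ℕ) : Set (sumZero (n + 1)) :=
  Subtype.val ⁻¹' regularPermutohedron (n + 1)

/-- The set is the bisector of 0 and v, a translate by v/2 of the proper subspace orthogonal to v.
-/
lemma volume_hyperplane_eq_zero {E : Type*} [NormedAddCommGroup E] [InnerProductSpace ℝ E]
    [FiniteDimensional ℝ E] [MeasurableSpace E] [BorelSpace E] {v : E} (hv : v ≠ 0) :
    volume {x : E | 2 * inner ℝ v x = ‖v‖ ^ 2} = 0 := by
  have hker : volume ((LinearMap.ker (innerₗ E v) : Submodule ℝ E) : Set E) = 0 := by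
    refine Measure.addHaar_submodule _ _ fun h => hv ?_
    rw [LinearMap.ker_eq_top] at h
    have := LinearMap.congr_fun h v
    simpa using this
  rw [← measure_preimage_add_right volume (-((1 / 2 : ℝ) • v))] at hker
  refine measure_mono_null (fun x hx => ?_) hker
  change inner ℝ v (x + -((1 / 2 : ℝ) • v)) = 0
  rw [Set.mem_ofPred_eq] at hx
  rw [inner_add_right, inner_neg_right, inner_smul_right, real_inner_self_eq_norm_sq]
  linarith

lemma isAddFundamentalDomain_permutohedronCell (n : ℕ) :
    IsAddFundamentalDomain (facetLattice n) (permutohedronCell n) volume := by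
  refine IsAddFundamentalDomain.mk'' ?_ ?_ ?_ ?_
  · exact ((isClosed_regularPermutohedron (n + 1)).preimage
      continuous_subtype_val).measurableSet.nullMeasurableSet
  · refine Eventually.of_forall fun x => ?_
    obtain ⟨v, hv, h⟩ := exists_sub_mem_regularPermutohedron n x
    refine ⟨-⟨v, hv⟩, ?_⟩
    rw [AddSubgroup.vadd_def, vadd_eq_add, permutohedronCell, Set.mem_preimage]
    convert h using 2
    simp [sub_eq_neg_add]
  · rintro ⟨v, hv⟩ hne
    have hv0 : v ≠ 0 := fun h => hne (Subtype.ext h)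
    refine measure_mono_null ?_ (volume_hyperplane_eq_zero hv0)
    rintro x ⟨⟨y, hy, rfl⟩, hx⟩
    -- If y and v + y both lie in the cell, the inequalities for v and -v force v + y onto the
    -- bisector of 0 and v.
    have h1 := two_mul_inner_le hx hv
    have h2 := two_mul_inner_le hy (neg_mem hv)
    change 2 * inner ℝ v (v + y) ≤ _ at h1
    change 2 * inner ℝ v (v + y) = _
    rw [norm_neg, inner_neg_left] at h2
    rw [inner_add_right, real_inner_self_eq_norm_sq] at h1 ⊢
    linarith
  · exact fun g => (measurePreserving_vadd g volume).quasiMeasurePreserving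

/-- The Gram matrix is (n+1)²(I - J/(n+1)) with J the all-ones matrix; the rank-one update has
determinant 1 - n/(n+1). -/
lemma det_gram_facetVector (n : ℕ) :
    (Matrix.of fun i j : Fin n => (inner ℝ (facetBasis n i) (facetBasis n j) : ℝ)).det =
      (n + 1) ^ (2 * n) / (n + 1) := by
  have h : (Matrix.of fun i j : Fin n => (inner ℝ (facetBasis n i) (facetBasis n j) : ℝ)) =
      ((n + 1 : ℝ) ^ 2) • (1 + Matrix.replicateCol Unit (fun _ : Fin n => -(1 / (n + 1 : ℝ))) *
        Matrix.replicateRow Unit (fun _ : Fin n => (1 : ℝ))) := by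
    ext i j
    rw [Matrix.of_apply, facetBasis_apply, facetBasis_apply, inner_facetVector, facetVector_apply]
    by_cases hij : i = j
    · subst hij
      simp [Matrix.mul_apply]
      field_simp
      ring
    · have hji : j ≠ i := fun h => hij h.symm
      simp [Matrix.mul_apply, hij, hji, Fin.castSucc_inj]
      field_simp
      ring
  rw [h, Matrix.det_smul, Matrix.det_one_add_replicateCol_mul_replicateRow, Fintype.card_fin,
    ← pow_mul]
  simp [dotProduct]
  field_simp
  ring

/-- Any two fundamental domains of the lattice have equal volume, so the cell is compared with the
basis parallelepiped. Its squared determinant in orthonormal coordinates is the Gram determinant. -/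
lemma volume_permutohedronCell (n : ℕ) :
    volume (permutohedronCell n) = ENNReal.ofReal ((n + 1) ^ n / √(n + 1)) := by
  have : DiscreteTopology (facetLattice n) :=
    inferInstanceAs (DiscreteTopology (Submodule.span ℤ (Set.range (facetBasis n))).toAddSubgroup)
  have : Countable (facetLattice n) := TopologicalSpace.separableSpace_iff_countable.mp inferInstance
  have h1 := (isAddFundamentalDomain_permutohedronCell n).measure_eq
    (ZSpan.isAddFundamentalDomain' (facetBasis n) volume)
  let b := (stdOrthonormalBasis ℝ (sumZero (n + 1))).reindex (finCongr (finrank_sumZero n))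
  rw [h1, ZSpan.measure_fundamentalDomain (facetBasis n) volume b.toBasis,
    measure_congr (ZSpan.fundamentalDomain_ae_parallelepiped b.toBasis volume),
    b.coe_toBasis, b.volume_parallelepiped, mul_one]
  congr 1
  have h2 : b.toBasis.det (facetBasis n) ^ 2 = (n + 1) ^ (2 * n) / (n + 1) := by
    rw [← det_gram_facetVector, Module.Basis.det_apply, sq]
    nth_rw 1 [← Matrix.det_transpose]
    rw [← Matrix.det_mul]
    congr 1
    ext i j
    rw [Matrix.mul_apply, Matrix.of_apply, ← b.sum_inner_mul_inner]
    refine sum_congr rfl fun k _ => ?_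
    rw [Matrix.transpose_apply, Module.Basis.toMatrix_apply, Module.Basis.toMatrix_apply,
      b.coe_toBasis_repr_apply, b.coe_toBasis_repr_apply, b.repr_apply_apply, b.repr_apply_apply,
      real_inner_comm]
  rw [← Real.sqrt_sq_eq_abs, h2, Real.sqrt_div (by positivity), mul_comm 2 n, pow_mul,
    Real.sqrt_sq (by positivity)]

lemma vol_eq_volume_preimage {n : ℕ} {S : Set (EuclideanSpace ℝ (Fin (n + 1)))}
    (hS : S ⊆ sumZero (n + 1)) :
    vol (n + 1) S = (volume (Subtype.val ⁻¹' S : Set (sumZero (n + 1)))).toReal := by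
  have hfin := InnerProductSpace.euclideanHausdorffMeasure_eq_volume (V := sumZero (n + 1))
  rw [finrank_sumZero] at hfin
  rw [← hfin, Isometry.euclideanHausdorffMeasure_preimage isometry_subtype_coe,
    Subtype.range_coe_subtype, vol, Nat.add_sub_cancel]
  congr 2
  exact (Set.inter_eq_left.mpr hS).symm

lemma vol_regularPermutohedron (n : ℕ) :
    vol (n + 1) (regularPermutohedron (n + 1)) = (n + 1) ^ n / √(n + 1) := by
  rw [vol_eq_volume_preimage (regularPermutohedron_subset_sumZero n)]
  change (volume (permutohedronCell n)).toReal = _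
  rw [volume_permutohedronCell, ENNReal.toReal_ofReal (by positivity)]

lemma vol_circumscribedBall {n : ℕ} (hn : 0 < n) :
    vol (n + 1) (circumscribedBall (n + 1)) =
      √(n * (n + 1) * (n + 2) / 12) ^ n * (√Real.pi ^ n / Real.Gamma (n / 2 + 1)) := by
  have hpre : (Subtype.val ⁻¹' circumscribedBall (n + 1) : Set (sumZero (n + 1))) =
      Metric.closedBall 0 ‖regularY (n + 1)‖ := by
    ext x
    simp [circumscribedBall]
  -- The ball volume formula used here is for nontrivial spaces, hence n > 0.
  have hnt : Nontrivial (sumZero (n + 1)) :=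
    Module.nontrivial_of_finrank_pos (R := ℝ) (by rwa [finrank_sumZero])
  have hG := Real.Gamma_pos_of_pos (show (0 : ℝ) < n / 2 + 1 by positivity)
  rw [vol_eq_volume_preimage (S := circumscribedBall (n + 1)) Set.inter_subset_right, hpre, InnerProductSpace.volume_closedBall,
    finrank_sumZero, ENNReal.toReal_mul, ENNReal.toReal_pow,
    ENNReal.toReal_ofReal (norm_nonneg _), ENNReal.toReal_ofReal (by positivity), norm_regularY]

lemma volumeRatio_eq_closedForm {n : ℕ} (hn : 0 < n) : volumeRatio (n + 1) = closedForm n := by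
  rw [volumeRatio, vol_regularPermutohedron, vol_circumscribedBall hn, closedForm]

end Volume

/-! ### Transfer to q and the geometric rate. -/

section Asymptotics

/-- The asymptotic value of the volume ratio. -/
noncomputable def asymptoticRatio (q : ℕ) : ℝ :=
  (Real.pi / Real.exp 1) ^ ((1 : ℝ) / 2) *
    (6 / (Real.pi * Real.exp 1)) ^ (((q : ℝ) - 1) / 2)

lemma asymptoticRatio_pos (q : ℕ) : 0 < asymptoticRatio q := by
  unfold asymptoticRatio
  positivity

lemma tendsto_volumeRatio_div :
    Tendsto (fun q => volumeRatio q / asymptoticRatio q) atTop (nhds 1) := by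
  rw [← tendsto_add_atTop_iff_nat 1]
  refine tendsto_closedForm_div.congr' ?_
  filter_upwards [eventually_gt_atTop 0] with n hn
  rw [volumeRatio_eq_closedForm hn, asymptoticRatio, Nat.cast_add, Nat.cast_one,
    add_sub_cancel_right]

lemma six_div_pi_mul_exp_lt_one : 6 / (Real.pi * Real.exp 1) < 1 := by
  rw [div_lt_one (by positivity)]
  nlinarith [Real.pi_gt_three, Real.exp_one_gt_d9]

/-- The asymptotic value as a geometric sequence with ratio `√(6 / (π e))`. -/
lemma asymptoticRatio_eq (q : ℕ) :
    asymptoticRatio q = (Real.pi / Real.exp 1) ^ ((1 : ℝ) / 2) *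
      √(6 / (Real.pi * Real.exp 1)) ^ q / √(6 / (Real.pi * Real.exp 1)) := by
  have hp : 0 < 6 / (Real.pi * Real.exp 1) := by positivity
  rw [asymptoticRatio, sub_div, Real.rpow_sub hp, ← Real.sqrt_eq_rpow (6 / _), mul_div_assoc,
    Real.sqrt_eq_rpow (6 / _), ← Real.rpow_natCast (_ ^ _) q, ← Real.rpow_mul hp.le]
  congr 3
  ring_nf

end Asymptotics

end Permutohedron

theorem proposition7p1 :
    -- the ratio of the volumes tends to zero
    Tendsto Permutohedron.volumeRatio atTop (nhds 0) ∧
    -- at a geometric rate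
    (∃ C : ℝ, 0 < C ∧ ∃ r : ℝ, 0 < r ∧ r < 1 ∧
      ∀ q : ℕ, 2 ≤ q → Permutohedron.volumeRatio q ≤ C * r ^ q) ∧
    -- with the exact asymptotics
    Asymptotics.IsEquivalent atTop Permutohedron.volumeRatio
      (fun q : ℕ => (Real.pi / Real.exp 1) ^ ((1 : ℝ) / 2) *
        (6 / (Real.pi * Real.exp 1)) ^ (((q : ℝ) - 1) / 2)) := by
  have hr0 : 0 < √(6 / (Real.pi * Real.exp 1)) := by positivity
  have hr1 : √(6 / (Real.pi * Real.exp 1)) < 1 := by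
    rw [Real.sqrt_lt' one_pos, one_pow]
    exact Permutohedron.six_div_pi_mul_exp_lt_one
  have heq : IsEquivalent atTop Permutohedron.volumeRatio
      Permutohedron.asymptoticRatio := by
    rw [isEquivalent_iff_tendsto_one
      (Eventually.of_forall fun q => (Permutohedron.asymptoticRatio_pos q).ne')]
    exact Permutohedron.tendsto_volumeRatio_div
  have hzero : Tendsto Permutohedron.asymptoticRatio atTop (nhds 0) := by
    have h := ((tendsto_pow_atTop_nhds_zero_of_lt_one hr0.le hr1).const_mul
      ((Real.pi / Real.exp 1) ^ ((1 : ℝ) / 2))).div_const √(6 / (Real.pi * Real.exp 1))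
    rw [mul_zero, zero_div] at h
    exact h.congr fun q => (Permutohedron.asymptoticRatio_eq q).symm
  refine ⟨heq.symm.tendsto_nhds hzero, ?_, heq⟩
  -- A convergent sequence is bounded, so a single constant serves every q; `max K 1` makes it
  -- positive.
  obtain ⟨K, hK⟩ := Permutohedron.tendsto_volumeRatio_div.bddAbove_range
  have hK1 : 0 < max K 1 := lt_max_of_lt_right one_pos
  refine ⟨max K 1 * (Real.pi / Real.exp 1) ^ ((1 : ℝ) / 2) / √(6 / (Real.pi * Real.exp 1)),
    by positivity, √(6 / (Real.pi * Real.exp 1)), hr0, hr1, fun q _ => ?_⟩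
  have h := (hK ⟨q, rfl⟩).trans (le_max_left K 1)
  rw [div_le_iff₀ (Permutohedron.asymptoticRatio_pos q), Permutohedron.asymptoticRatio_eq] at h
  refine h.trans_eq ?_
  ring
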